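/- Let $X\subseteq\mathbb R^1=\mathbb R$ be any set of points, finite or infinite. Let $\mathcal R$ be the Vietoris–Rips complex of $X$ at scale $1$, that is, the abstract simplicial complex whose simplices are the nonempty finite subsets of $X$ of diameter at most $1$, and let $|\mathcal R|$ be its geometric realization with the weak topology. Let $p\colon|\mathcal R|\to\mathbb R$ be the projection that maps each simplex affinely onto the convex hull of its vertices in $\mathbb R$, fixing the vertices, and let the shadow $\mathcal S=p(|\mathcal R|)$ carry the subspace topology of $\mathbb R$. Then $p\colon|\mathcal R|\to\mathcal S$ is a homotopy equivalence. -/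

import Mathlib

/-- The Vietoris-Rips complex of a set `X` at scale `ε`: its simplices are the nonempty finite
subsets of `X` of diameter at most `ε`. -/
def ripsComplex {E : Type*} [PseudoMetricSpace E] (ε : ℝ) (X : Set E) :
    PreAbstractSimplicialComplex E where
  faces := {s | s.Nonempty ∧ (s : Set E) ⊆ X ∧ Metric.diam (s : Set E) ≤ ε}
  isRelLowerSet_faces := by
    rintro s ⟨hs, hX, hd⟩
    refine ⟨hs, fun t hts ht => ⟨ht, ?_, ?_⟩⟩
    · exact (Finset.coe_subset.2 hts).trans hX
    · exact (Metric.diam_mono (Finset.coe_subset.2 hts) s.finite_toSet.isBounded).trans hd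

namespace PreAbstractSimplicialComplex

/-- The points of the geometric realization of an abstract simplicial complex, in barycentric
coordinates: formal convex combinations of the vertices of some simplex. -/
def Realization {V : Type*} (K : PreAbstractSimplicialComplex V) : Type _ :=
  {x : V →₀ ℝ // (∀ v, 0 ≤ x v) ∧ (x.sum fun _ a => a) = 1 ∧ x.support ∈ K.faces}

open Classical in
/-- Extension by zero of the barycentric coordinates on a simplex. -/
noncomputable def extendCoord {V : Type*} (s : Finset V) (w : s → ℝ) : V →₀ ℝ :=
  Finsupp.onFinset s (fun v => if h : v ∈ s then w ⟨v, h⟩ else 0) (by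
    intro v hv
    by_contra h
    exact hv (dif_neg h))

theorem extendCoord_apply_mem {V : Type*} (s : Finset V) (w : s → ℝ) (v : s) :
    extendCoord s w v = w v := by
  simp [extendCoord]

theorem extendCoord_support_subset {V : Type*} (s : Finset V) (w : s → ℝ) :
    (extendCoord s w).support ⊆ s :=
  Finsupp.support_onFinset_subset

theorem extendCoord_sum {V M : Type*} [AddCommMonoid M] (s : Finset V) (w : s → ℝ)
    (g : V → ℝ → M) (hg : ∀ v, g v 0 = 0) :
    (extendCoord s w).sum g = ∑ v : s, g v (w v) := by
  rw [Finsupp.sum_of_support_subset _ (extendCoord_support_subset s w) g fun v _ => hg v,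
    ← Finset.sum_coe_sort s]
  exact Finset.sum_congr rfl fun v _ => by rw [extendCoord_apply_mem]

/-- The characteristic map of a simplex `s` of `K`, from the standard geometric simplex on the
vertices of `s` (with its Euclidean topology) to the realization of `K`. -/
noncomputable def Realization.simplexMap {V : Type*} (K : PreAbstractSimplicialComplex V)
    (s : K.faces) (w : stdSimplex ℝ (s : Finset V)) : K.Realization :=
  ⟨extendCoord s w.1, by
    have hsum : ((extendCoord (s : Finset V) w.1).sum fun _ a => a) = 1 := by
      rw [extendCoord_sum _ _ _ fun _ => rfl]
      exact w.2.2
    refine ⟨fun v => ?_, hsum, ?_⟩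
    · by_cases h : v ∈ (s : Finset V)
      · rw [extendCoord_apply_mem _ w.1 ⟨v, h⟩]
        exact w.2.1 _
      · rw [Finsupp.notMem_support_iff.1 fun h' => h (extendCoord_support_subset _ _ h')]
    · refine (K.isRelLowerSet_faces s.2).2 (extendCoord_support_subset _ _) ?_
      rw [Finset.nonempty_iff_ne_empty]
      intro h
      rw [Finsupp.sum, h, Finset.sum_empty] at hsum
      exact zero_ne_one hsum⟩

/-- The weak topology on the geometric realization: the finest one for which the
characteristic maps of all simplices are continuous. -/
noncomputable instance Realization.instTopologicalSpace {V : Type*} (K : PreAbstractSimplicialComplex V) : TopologicalSpace K.Realization :=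
  ⨆ s : K.faces, TopologicalSpace.coinduced (Realization.simplexMap K s) inferInstance

theorem Realization.continuous_iff {V Y : Type*} [TopologicalSpace Y]
    (K : PreAbstractSimplicialComplex V) (f : K.Realization → Y) :
    Continuous f ↔ ∀ s : K.faces, Continuous (f ∘ Realization.simplexMap K s) := by
  rw [continuous_iSup_dom]
  exact forall_congr' fun s => continuous_coinduced_dom

section Shadow

variable {E : Type*} [AddCommGroup E] [Module ℝ E]

/-- For a complex whose vertices are points of `E`, the map to `E` that is affine on every
simplex and fixes the vertices. -/
noncomputable def proj (K : PreAbstractSimplicialComplex E) (x : K.Realization) : E :=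
  x.1.sum fun v a => a • v

/-- The shadow of a complex whose vertices are points of `E`: the image of the projection. -/
def shadow (K : PreAbstractSimplicialComplex E) : Set E :=
  Set.range K.proj

variable [TopologicalSpace E] [ContinuousAdd E] [ContinuousSMul ℝ E]

theorem continuous_proj (K : PreAbstractSimplicialComplex E) : Continuous K.proj := by
  rw [Realization.continuous_iff]
  intro s
  have h : K.proj ∘ Realization.simplexMap K s =
      fun w : stdSimplex ℝ (s : Finset E) => ∑ v : (s : Finset E), w.1 v • (v : E) := by
    funext w
    exact extendCoord_sum (s : Finset E) w.1 (fun v a => a • v) fun v => zero_smul ℝ v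
  rw [h]
  exact continuous_finsetSum _ fun v _ =>
    ((continuous_apply v).comp continuous_subtype_val).smul continuous_const

/-- The projection from the geometric realization of a complex onto its shadow, which has the
subspace topology. -/
noncomputable def shadowProj (K : PreAbstractSimplicialComplex E) :
    C(K.Realization, K.shadow) where
  toFun x := ⟨K.proj x, x, rfl⟩
  continuous_toFun := K.continuous_proj.subtype_mk _

end Shadow

end PreAbstractSimplicialComplex

/-!
Let `p : |K| → S` be the projection from the realization of the Vietoris–Rips complex of `X ⊆ ℝ` to
its shadow. Instead of looking for a section of `p`, both spaces are contracted onto the same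
discrete set, simultaneously in all components.

Call two points of `X` equivalent if a finite chain of points of `X` with steps of length at most
`1` joins them (`chainSetoid`), and choose a point `chainBase` in every class. Near a point of `S`
there are points of exactly one class, and this class does not change when the point moves by at
most `1`. Hence the map `q : S → |K|` that sends a point to the chosen vertex of its class is
locally constant, so continuous. The map `p ∘ q` moves points of `S` along line segments inside
`S` (`uIcc_shadowBase_subset`) and is therefore homotopic to the identity.

The map `q ∘ p` is simplicial: it sends each vertex to the chosen vertex of its class. To connect
it with the identity of `|K|`, exhaust every class by intervals with end points in the class, which
start from the chosen point and grow by at most `1` on either side in each step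
(`exists_exhausting_bounds`). Let `φ n` clamp each class to its `n`-th interval. Consecutive maps
are contiguous (`dist_clamp_clamp_le_one`): if all vertices of a simplex lie above the `n`-th
interval, they are clamped first to its upper end `b` and then to points of `[b, b + 1]`. Every
vertex is eventually fixed, so the infinitely many straight-line homotopies from `φ n` to
`φ (n + 1)`, run on the time intervals `[2⁻¹ ^ (n + 1), 2⁻¹ ^ n]`, extend by the identity at time
`0` (`exists_homotopy_id_of_contiguous`). Continuity for the weak topology may be tested on the
product of a simplex with the unit interval, where only finitely many stages, and hence finitely
many vertices, are involved, and there it is coordinatewise continuity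
(`Realization.continuous_prod`, `Realization.continuous_of_support_subset`).
-/

open scoped unitInterval

namespace PreAbstractSimplicialComplex

/-! ### Maps into and out of the geometric realization -/

variable {V : Type*} (K : PreAbstractSimplicialComplex V)

theorem Realization.support_nonempty {K : PreAbstractSimplicialComplex V} (z : K.Realization) :
    z.1.support.Nonempty :=
  (K.isRelLowerSet_faces z.2.2.2).1

theorem mem_faces_of_support_subset {s : Finset V} (hs : s ∈ K.faces) {x : V →₀ ℝ}
    (h1 : (x.sum fun _ a => a) = 1) (hx : x.support ⊆ s) : x.support ∈ K.faces := by
  refine (K.isRelLowerSet_faces hs).2 hx (Finset.nonempty_iff_ne_empty.2 fun h => ?_)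
  rw [Finsupp.sum, h, Finset.sum_empty] at h1
  exact zero_ne_one h1

theorem Realization.exists_simplexMap_eq (z : K.Realization) {s : Finset V} (hs : s ∈ K.faces)
    (hz : z.1.support ⊆ s) :
    ∃ w : stdSimplex ℝ s, (∀ v : s, w.1 v = z.1 v) ∧ simplexMap K ⟨s, hs⟩ w = z := by
  refine ⟨⟨fun v => z.1 v, fun v => z.2.1 v, ?_⟩, fun v => rfl, Subtype.ext ?_⟩
  · rw [Finset.sum_coe_sort s (fun v => z.1 v)]
    exact (Finsupp.sum_of_support_subset _ hz _ fun _ _ => rfl).symm.trans z.2.2.1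
  · ext v
    by_cases hv : v ∈ s
    · exact extendCoord_apply_mem s _ ⟨v, hv⟩
    · have h1 : v ∉ z.1.support := fun h => hv (hz h)
      have h2 : v ∉ (extendCoord s fun v : s => z.1 v).support :=
        fun h => hv (extendCoord_support_subset _ _ h)
      exact (Finsupp.notMem_support_iff.1 h2).trans (Finsupp.notMem_support_iff.1 h1).symm

theorem Realization.continuous_of_support_subset_face {T : Type*} [TopologicalSpace T]
    (f : T → K.Realization) {s : Finset V} (hs : s ∈ K.faces) (hf : ∀ t, (f t).1.support ⊆ s)
    (hc : ∀ v, Continuous fun t => (f t).1 v) : Continuous f := by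
  choose w hw hwf using fun t => exists_simplexMap_eq K (f t) hs (hf t)
  have hwc : Continuous w := by
    refine Continuous.subtype_mk (f := fun t => (w t).1) (continuous_pi fun v => ?_) fun t => (w t).2
    simpa only [hw] using hc v
  have : f = simplexMap K ⟨s, hs⟩ ∘ w := funext fun t => (hwf t).symm
  rw [this]
  exact ((continuous_iff K id).1 continuous_id ⟨s, hs⟩).comp hwc

/-- On a finite subcomplex the weak topology is the topology of coordinatewise convergence: the
preimages of the faces inside `s` form a finite closed cover of the source. -/
theorem Realization.continuous_of_support_subset {T : Type*} [TopologicalSpace T]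
    (f : T → K.Realization) (s : Finset V) (hf : ∀ t, (f t).1.support ⊆ s)
    (hc : ∀ v, Continuous fun t => (f t).1 v) : Continuous f := by
  let ι := {r : s.powerset // (r : Finset V) ∈ K.faces}
  let A : ι → Set T := fun r => {t | (f t).1.support ⊆ (r.1 : Finset V)}
  have hA : ∀ r, A r = ⋂ v ∈ ((r.1 : Finset V) : Set V)ᶜ, {t | (f t).1 v = 0} := by
    intro r
    ext t
    simp only [A, Set.mem_ofPred_eq, Set.mem_iInter, Set.mem_compl_iff, Finset.mem_coe,
      Finset.subset_iff, Finsupp.mem_support_iff]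
    exact forall_congr' fun v => not_imp_comm
  refine (locallyFinite_of_finite A).continuous ?_ ?_ ?_
  · refine Set.eq_univ_of_forall fun t => Set.mem_iUnion.2 ?_
    exact ⟨⟨⟨(f t).1.support, Finset.mem_powerset.2 (hf t)⟩, (f t).2.2.2⟩, Finset.Subset.refl _⟩
  · intro r
    rw [hA]
    exact isClosed_biInter fun v _ => isClosed_eq (hc v) continuous_const
  · intro r
    rw [continuousOn_iff_continuous_domRestrict]
    exact continuous_of_support_subset_face K _ r.2 (fun t => t.2)
      fun v => (hc v).comp continuous_subtype_val

/-- The product of the realization with a locally compact space still has the topology coinduced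
from the products of the simplices: pass to the curried map. -/
theorem Realization.continuous_prod {T Y : Type*} [TopologicalSpace T] [LocallyCompactSpace T]
    [TopologicalSpace Y] (f : T × K.Realization → Y)
    (hf : ∀ s : K.faces, Continuous fun p : T × stdSimplex ℝ (s : Finset V) =>
      f (p.1, simplexMap K s p.2)) : Continuous f := by
  have hz : ∀ z : K.Realization, Continuous fun t => f (t, z) := by
    intro z
    obtain ⟨w, -, hw⟩ := exists_simplexMap_eq K z z.2.2.2 subset_rfl
    rw [← hw]
    exact (hf ⟨_, z.2.2.2⟩).comp (Continuous.prodMk continuous_id continuous_const)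
  let g : K.Realization → C(T, Y) := fun z => ⟨fun t => f (t, z), hz z⟩
  have hg : Continuous g := (continuous_iff K g).2 fun s =>
    ContinuousMap.continuous_of_continuous_uncurry _ ((hf s).comp continuous_swap)
  exact (ContinuousMap.continuous_uncurry_of_continuous ⟨g, hg⟩).comp continuous_swap

/-! ### Maps that are affine on simplices, and homotopies through them -/

/-- The points `γ x`, given in barycentric coordinates, are admissible images of the vertices `x`
of `K` for an affine extension: the images of the vertices of a simplex lie in a common simplex. -/
def IsAffinelyExtendable (γ : V → V →₀ ℝ) : Prop :=
  ∀ s ∈ K.faces, ∃ s' ∈ K.faces, ∀ x ∈ s,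
    (∀ v, 0 ≤ γ x v) ∧ ((γ x).sum fun _ a => a) = 1 ∧ (γ x).support ⊆ s'

/-- The self-map of the realization that is affine on every simplex and maps each vertex `x` to
`γ x`. -/
noncomputable def affineExtension {γ : V → V →₀ ℝ} (h : K.IsAffinelyExtendable γ)
    (z : K.Realization) : K.Realization :=
  ⟨z.1.sum fun x a => a • γ x, by
    obtain ⟨s', hs', hγ⟩ := h _ z.2.2.2
    have hsum : ((z.1.sum fun x a => a • γ x).sum fun _ a => a) = 1 := by
      rw [Finsupp.sum_sum_index (fun _ => rfl) (fun _ _ _ => rfl)]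
      refine Eq.trans (Finset.sum_congr rfl fun x hx => ?_) z.2.2.1
      dsimp only
      rw [Finsupp.sum_smul_index (fun _ => rfl), ← Finsupp.mul_sum, (hγ x hx).2.1, mul_one]
    refine ⟨fun v => ?_, hsum, K.mem_faces_of_support_subset hs' hsum fun v hv => ?_⟩
    · rw [Finsupp.sum, Finsupp.finsetSum_apply]
      exact Finset.sum_nonneg fun x hx => mul_nonneg (z.2.1 x) ((hγ x hx).1 v)
    · rw [Finsupp.mem_support_iff, Finsupp.sum, Finsupp.finsetSum_apply] at hv
      obtain ⟨x, hx, hxv⟩ := Finset.exists_ne_zero_of_sum_ne_zero hv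
      exact (hγ x hx).2.2 (Finsupp.mem_support_iff.2 (right_ne_zero_of_mul hxv))⟩

theorem affineExtension_simplexMap {γ : V → V →₀ ℝ} (h : K.IsAffinelyExtendable γ) (s : K.faces)
    (w : stdSimplex ℝ (s : Finset V)) :
    (K.affineExtension h (Realization.simplexMap K s w)).1 =
      ∑ x : (s : Finset V), w.1 x • γ x :=
  extendCoord_sum (s : Finset V) w.1 (fun x a => a • γ x) fun _ => zero_smul ℝ _

theorem continuous_affineExtension {T : Type*} [TopologicalSpace T] [LocallyCompactSpace T]
    {γ : T → V → V →₀ ℝ} (h : ∀ t, K.IsAffinelyExtendable (γ t))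
    (hc : ∀ x v, Continuous fun t => γ t x v)
    (hfin : ∀ x, ∃ s : Finset V, ∀ t, (γ t x).support ⊆ s) :
    Continuous fun p : T × K.Realization => K.affineExtension (h p.1) p.2 := by
  classical
  refine Realization.continuous_prod K _ fun s => ?_
  choose F hF using hfin
  refine Realization.continuous_of_support_subset K _ ((s : Finset V).biUnion F)
    (fun p v hv => ?_) fun v => ?_
  · dsimp only at hv
    rw [affineExtension_simplexMap, Finsupp.mem_support_iff, Finsupp.finsetSum_apply] at hv
    obtain ⟨x, -, hx⟩ := Finset.exists_ne_zero_of_sum_ne_zero hv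
    exact Finset.mem_biUnion.2
      ⟨x, x.2, hF _ _ (Finsupp.mem_support_iff.2 (right_ne_zero_of_mul hx))⟩
  · simp only [affineExtension_simplexMap, Finsupp.finsetSum_apply, Finsupp.smul_apply, smul_eq_mul]
    exact continuous_finsetSum _ fun x _ =>
      (((continuous_apply x).comp continuous_subtype_val).comp continuous_snd).mul
        ((hc x v).comp continuous_fst)

/-! ### Telescopes of contiguous vertex maps -/

/-- The weight of the `n`-th stage of a telescope at time `t`: it grows linearly from `0` to `1`
while `t` runs through `[2⁻¹ ^ (n + 1), 2⁻¹ ^ n]`. -/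
noncomputable def stageWeight (n : ℕ) (t : ℝ) : ℝ :=
  max 0 (min 1 (2 ^ (n + 1) * t - 1))

theorem stageWeight_mem_Icc (n : ℕ) (t : ℝ) : stageWeight n t ∈ Set.Icc (0 : ℝ) 1 :=
  ⟨le_max_left _ _, max_le zero_le_one (min_le_left _ _)⟩

theorem stageWeight_zero (n : ℕ) : stageWeight n 0 = 0 := by
  simp [stageWeight]

theorem stageWeight_one (n : ℕ) : stageWeight n 1 = 1 := by
  have : (2 : ℝ) ≤ 2 ^ (n + 1) := le_self_pow₀ one_le_two n.succ_ne_zero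
  rw [stageWeight, min_eq_left (by linarith), max_eq_right zero_le_one]

theorem continuous_stageWeight (n : ℕ) : Continuous (stageWeight n) := by
  unfold stageWeight
  fun_prop

/-- At every time at most one stage is in progress. The bound `N` only matters at `t = 0`, where no
stage has begun. -/
theorem exists_stage {t : ℝ} (h0 : 0 ≤ t) (h1 : t ≤ 1) (N : ℕ) :
    ∃ i, (∀ n < i, stageWeight n t = 0) ∧ ∀ n, i < n → n < N → stageWeight n t = 1 := by
  rcases h0.eq_or_lt with rfl | h0
  · exact ⟨N, fun n _ => stageWeight_zero n, fun n h h' => absurd h h'.le.not_gt⟩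
  obtain ⟨i, hi, hi'⟩ :=
    exists_nat_pow_near_of_lt_one h0 h1 (y := (2 : ℝ)⁻¹) (by norm_num) (by norm_num)
  refine ⟨i, fun n hn => ?_, fun n hn _ => ?_⟩
  · have h2 : (2 : ℝ) ^ (n + 1) ≤ 2 ^ i := pow_le_pow_right₀ one_le_two hn
    have : (2 : ℝ) ^ (n + 1) * t ≤ 1 := by
      calc (2 : ℝ) ^ (n + 1) * t ≤ 2 ^ i * 2⁻¹ ^ i := mul_le_mul h2 hi' h0.le (by positivity)
        _ = 1 := by rw [← mul_pow]; norm_num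
    exact max_eq_left ((min_le_right _ _).trans (by linarith))
  · have h2 : (2 : ℝ) ^ (i + 1 + 1) ≤ 2 ^ (n + 1) :=
      pow_le_pow_right₀ one_le_two (Nat.succ_le_succ hn)
    have : 2 ≤ (2 : ℝ) ^ (n + 1) * t := by
      calc (2 : ℝ) = 2 ^ (i + 1 + 1) * 2⁻¹ ^ (i + 1) := by
            rw [pow_succ _ (i + 1), mul_right_comm, ← mul_pow]; norm_num
        _ ≤ 2 ^ (n + 1) * t := mul_le_mul h2 hi.le (by positivity) (by positivity)
    rw [stageWeight, min_eq_left (by linarith), max_eq_right zero_le_one]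

/-- If the stages before `i` have not begun and those after `i` are complete, the telescoping sum
is a convex combination of the consecutive terms `e i` and `e (i + 1)`. -/
theorem telescope_eq {M : Type*} [AddCommGroup M] [Module ℝ M] (e : ℕ → M) (a : ℕ → ℝ) (i N : ℕ)
    (h0 : ∀ n < i, a n = 0) (h1 : ∀ n, i < n → n < N → a n = 1) (he : ∀ n, N ≤ n → e n = e N) :
    e N + ∑ n ∈ Finset.range N, a n • (e n - e (n + 1)) = a i • e i + (1 - a i) • e (i + 1) := by
  rcases le_or_gt N i with hN | hN
  · rw [Finset.sum_eq_zero fun n hn => by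
      rw [h0 n ((Finset.mem_range.1 hn).trans_le hN), zero_smul], he i hN, he (i + 1) (by omega)]
    module
  · obtain ⟨k, rfl⟩ : ∃ k, N = i + 1 + k := ⟨N - (i + 1), by omega⟩
    have htel : ∑ n ∈ Finset.range k, (e (i + 1 + n) - e (i + 1 + n + 1)) =
        e (i + 1) - e (i + 1 + k) := Finset.sum_range_sub' (fun n => e (i + 1 + n)) k
    rw [Finset.sum_range_add, Finset.sum_range_succ, Finset.sum_eq_zero fun n hn => by
      rw [h0 n (Finset.mem_range.1 hn), zero_smul]]
    rw [Finset.sum_congr rfl fun n hn => by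
      rw [h1 (i + 1 + n) (by omega) (by have := Finset.mem_range.1 hn; omega), one_smul], htel]
    module

/-- If the vertex maps `φ n` and `φ (n + 1)` are contiguous for all `n` and every vertex is
eventually fixed, then the infinitely many straight-line homotopies between consecutive maps
fit together to a homotopy from the identity to the map induced by `φ 0`. -/
theorem exists_homotopy_id_of_contiguous (φ : ℕ → V → V)
    (hφ : ∀ s ∈ K.faces, ∀ n, ∃ s' ∈ K.faces, ∀ x ∈ s, φ n x ∈ s' ∧ φ (n + 1) x ∈ s')
    (hfix : ∀ x, ∃ N, ∀ n, N ≤ n → φ n x = x) :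
    ∃ H : C(I × K.Realization, K.Realization), (∀ z, H (0, z) = z) ∧
      ∀ z, (H (1, z)).1 = z.1.mapDomain (φ 0) := by
  classical
  choose N hN using hfix
  let e : V → ℕ → V →₀ ℝ := fun x n => Finsupp.single (φ n x) 1
  -- The path of the vertex `x`; the sum may stop at `N x`, where its terms become zero.
  let γ : I → V → V →₀ ℝ := fun t x =>
    e x (N x) + ∑ n ∈ Finset.range (N x), stageWeight n t • (e x n - e x (n + 1))
  have he : ∀ x, e x (N x) = Finsupp.single x 1 := fun x => by simp only [e, hN x _ le_rfl]
  have heN : ∀ x n, N x ≤ n → e x n = e x (N x) := fun x n hn => by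
    simp only [e, hN x _ le_rfl, hN x n hn]
  have hγ : ∀ t, K.IsAffinelyExtendable (γ t) := by
    intro t s hs
    obtain ⟨i, hi0, hi1⟩ := exists_stage t.2.1 t.2.2 (s.sup N)
    obtain ⟨s', hs', hφs⟩ := hφ s hs i
    refine ⟨s', hs', fun x hx => ?_⟩
    have hγx : γ t x = Finsupp.single (φ i x) (stageWeight i t) +
        Finsupp.single (φ (i + 1) x) (1 - stageWeight i t) := by
      have := telescope_eq (e x) (fun n => stageWeight n t) i (N x) hi0
        (fun n h h' => hi1 n h (h'.trans_le (Finset.le_sup hx))) (heN x)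
      simpa only [e, Finsupp.smul_single, smul_eq_mul, mul_one] using this
    obtain ⟨ha0, ha1⟩ := stageWeight_mem_Icc i t
    rw [hγx]
    refine ⟨fun v => ?_, ?_, ?_⟩
    · rw [Finsupp.add_apply, Finsupp.single_apply, Finsupp.single_apply]
      split_ifs <;> linarith
    · rw [Finsupp.sum_add_index' (fun _ => rfl) (fun _ _ _ => rfl), Finsupp.sum_single_index rfl,
        Finsupp.sum_single_index rfl, add_sub_cancel]
    · refine Finsupp.support_add.trans (Finset.union_subset ?_ ?_)
      · exact Finsupp.support_single_subset.trans (Finset.singleton_subset_iff.2 (hφs x hx).1)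
      · exact Finsupp.support_single_subset.trans (Finset.singleton_subset_iff.2 (hφs x hx).2)
  have hc : Continuous fun p : I × K.Realization => K.affineExtension (hγ p.1) p.2 := by
    refine K.continuous_affineExtension hγ (fun x v => ?_) fun x => ?_
    · simp only [γ, Finsupp.add_apply, Finsupp.finsetSum_apply, Finsupp.smul_apply]
      exact continuous_const.add (continuous_finsetSum _ fun n _ =>
        ((continuous_stageWeight n).comp continuous_subtype_val).smul continuous_const)
    · refine ⟨(Finset.range (N x + 1)).image fun n => φ n x, fun t v hv => ?_⟩
      by_contra hvn
      have hev : ∀ n ≤ N x, e x n v = 0 := fun n hn =>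
        Finsupp.single_eq_of_ne fun h =>
          hvn (Finset.mem_image.2 ⟨n, Finset.mem_range.2 (by omega), h.symm⟩)
      refine Finsupp.mem_support_iff.1 hv ?_
      simp only [γ, Finsupp.add_apply, Finsupp.finsetSum_apply, Finsupp.smul_apply,
        Finsupp.sub_apply, hev _ le_rfl, zero_add]
      refine Finset.sum_eq_zero fun n hn => ?_
      have := Finset.mem_range.1 hn
      rw [hev n (by omega), hev (n + 1) (by omega), sub_zero, smul_zero]
  refine ⟨⟨_, hc⟩, fun z => Subtype.ext ?_, fun z => ?_⟩
  · have h0 : γ 0 = fun x => Finsupp.single x 1 := by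
      funext x
      simp only [γ, he, Set.Icc.coe_zero, stageWeight_zero, zero_smul, Finset.sum_const_zero,
        add_zero]
    change (z.1.sum fun x a => a • γ 0 x) = z.1
    simp only [h0, Finsupp.smul_single, smul_eq_mul, mul_one, Finsupp.sum_single]
  · have h1 : γ 1 = fun x => Finsupp.single (φ 0 x) 1 := by
      funext x
      simp only [γ, Set.Icc.coe_one, stageWeight_one, one_smul, Finset.sum_range_sub', e,
        add_sub_cancel]
    change (z.1.sum fun x a => a • γ 1 x) = _
    simp only [h1, Finsupp.smul_single, smul_eq_mul, mul_one]
    rfl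

end PreAbstractSimplicialComplex

/-! ### Exhausting a class of a relation by finite sets that grow by single steps -/

theorem Relation.ReflTransGen.exists_seq {α : Type*} {R : α → α → Prop} (hR : ∀ x, R x x)
    {x y : α} (h : Relation.ReflTransGen R x y) :
    ∃ g : ℕ → α, g 0 = x ∧ (∀ n, R (g n) (g (n + 1))) ∧ ∃ n, g n = y := by
  induction h with
  | refl => exact ⟨fun _ => x, rfl, fun _ => hR x, 0, rfl⟩
  | @tail b c _ hbc ih =>
    obtain ⟨g, h0, hg, N, rfl⟩ := ih
    refine ⟨fun n => if n ≤ N then g n else c, by simpa using h0, fun n => ?_, N + 1, by simp⟩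
    rcases lt_trichotomy n N with h | rfl | h
    · simpa [h.le, Nat.succ_le_of_lt h] using hg n
    · simpa using hbc
    · simpa [h.not_ge, (Nat.lt_succ_of_lt h).not_ge] using hR c

/-- Countably many points that can be reached from `x₀` are exhausted by an increasing sequence of
finite sets, each of which is obtained from the previous one by single steps. -/
theorem exists_finset_filtration {α : Type*} {R : α → α → Prop} (hR : ∀ x, R x x) (x₀ : α)
    (f : ℕ → α) (hf : ∀ i, Relation.ReflTransGen R x₀ (f i)) :
    ∃ F : ℕ → Finset α, F 0 = {x₀} ∧ Monotone F ∧ (∀ n, ∀ y ∈ F (n + 1), ∃ x ∈ F n, R x y) ∧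
      ∀ i, ∃ n, f i ∈ F n := by
  classical
  choose g hg0 hg hgf using fun i => (hf i).exists_seq hR
  -- At stage `n` the first `n - i` steps of the path towards `f i` have been made.
  let F : ℕ → Finset α := fun n =>
    ((Finset.range (n + 1) ×ˢ Finset.range (n + 1)).filter fun p => p.1 + p.2 ≤ n).image
      fun p => g p.1 p.2
  have hF : ∀ n y, y ∈ F n ↔ ∃ i j, i + j ≤ n ∧ g i j = y := by
    intro n y
    simp only [F, Finset.mem_image, Finset.mem_filter, Finset.mem_product, Finset.mem_range,
      Prod.exists]
    exact ⟨fun ⟨i, j, h, hy⟩ => ⟨i, j, h.2, hy⟩, fun ⟨i, j, h, hy⟩ => ⟨i, j, by omega, hy⟩⟩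
  refine ⟨F, ?_, fun m n hmn y hy => ?_, fun n y hy => ?_, fun i => ?_⟩
  · ext y
    rw [hF, Finset.mem_singleton]
    constructor
    · rintro ⟨i, j, h, rfl⟩
      obtain rfl : j = 0 := by omega
      exact hg0 i
    · rintro rfl
      exact ⟨0, 0, le_rfl, hg0 0⟩
  · obtain ⟨i, j, h, hy⟩ := (hF _ _).1 hy
    exact (hF _ _).2 ⟨i, j, h.trans hmn, hy⟩
  · obtain ⟨i, j, h, rfl⟩ := (hF _ _).1 hy
    cases j with
    | zero => exact ⟨x₀, (hF _ _).2 ⟨0, 0, by omega, hg0 0⟩, by rw [hg0]; exact hR x₀⟩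
    | succ j => exact ⟨g i j, (hF _ _).2 ⟨i, j, by omega, rfl⟩, hg i j⟩
  · obtain ⟨n, hn⟩ := hgf i
    exact ⟨i + n, (hF _ _).2 ⟨i, n, le_rfl, hn⟩⟩

/-! ### Chains of steps of length at most one -/

/-- Two points of `X` are equivalent if they are joined by a finite chain of points of `X` with
consecutive distances at most `1`. -/
def chainSetoid (X : Set ℝ) : Setoid X where
  r := Relation.ReflTransGen fun x y => dist x y ≤ 1
  iseqv := ⟨fun _ => .refl,
    fun h =>
      have : Std.Symm fun x y : X => dist x y ≤ 1 := ⟨fun x y h => by rwa [dist_comm]⟩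
      Std.Symm.symm _ _ h,
    fun h h' => h.trans h'⟩

/-- The chosen point in the chain class of `x`. -/
noncomputable def chainBase {X : Set ℝ} (x : X) : X :=
  (Quotient.mk (chainSetoid X) x).out

section

variable {X : Set ℝ}

theorem chainSetoid_of_dist_le {x y : X} (h : dist x y ≤ 1) : chainSetoid X x y :=
  Relation.ReflTransGen.single h

theorem chainBase_rel (x : X) : chainSetoid X (chainBase x) x :=
  Quotient.mk_out (s := chainSetoid X) x

theorem chainBase_eq {x y : X} (h : chainSetoid X x y) : chainBase x = chainBase y :=
  congrArg Quotient.out (Quotient.sound (s := chainSetoid X) h)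

/-- A chain class is exhausted by intervals whose end points belong to the class and move by at
most `1` in each step. A countable subset that is cofinal in both directions suffices. -/
theorem exists_exhausting_bounds (x₀ : X) :
    ∃ lo hi : ℕ → X, (lo 0 = x₀ ∧ hi 0 = x₀) ∧ (Antitone lo ∧ Monotone hi) ∧
      (∀ n, (lo n : ℝ) - 1 ≤ lo (n + 1) ∧ (hi (n + 1) : ℝ) ≤ hi n + 1) ∧
      ∀ y, chainSetoid X x₀ y → ∃ N, ∀ n, N ≤ n → lo n ≤ y ∧ y ≤ hi n := by
  let C := {y : X // chainSetoid X x₀ y}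
  obtain ⟨D, hDc, hD, hbot, htop⟩ := exists_countable_dense_bot_top C
  have hne : D.Nonempty := hD.nonempty_iff.2 ⟨⟨x₀, (chainSetoid X).refl x₀⟩⟩
  obtain ⟨f, rfl⟩ := hDc.exists_eq_range hne
  have hup : ∀ y : C, ∃ i, y ≤ f i := by
    intro y
    by_cases hy : IsTop y
    · obtain ⟨i, hi⟩ := htop y hy
      exact ⟨i, hi.ge⟩
    · obtain ⟨z, hz⟩ := not_forall.1 hy
      obtain ⟨-, hw, i, rfl⟩ := hD.inter_open_nonempty _ isOpen_Ioi ⟨z, not_le.1 hz⟩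
      exact ⟨i, le_of_lt hw⟩
  have hdown : ∀ y : C, ∃ i, f i ≤ y := by
    intro y
    by_cases hy : IsBot y
    · obtain ⟨i, hi⟩ := hbot y hy
      exact ⟨i, hi.le⟩
    · obtain ⟨z, hz⟩ := not_forall.1 hy
      obtain ⟨-, hw, i, rfl⟩ := hD.inter_open_nonempty _ isOpen_Iio ⟨z, not_le.1 hz⟩
      exact ⟨i, le_of_lt hw⟩
  obtain ⟨F, hF0, hFm, hFs, hFf⟩ := exists_finset_filtration (R := fun x y : X => dist x y ≤ 1)
    (fun x => by simp) x₀ (fun i => f i) fun i => (f i).2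
  have hFne : ∀ n, (F n).Nonempty := fun n =>
    ⟨x₀, hFm n.zero_le (hF0 ▸ Finset.mem_singleton_self x₀)⟩
  refine ⟨fun n => (F n).min' (hFne n), fun n => (F n).max' (hFne n), by simp [hF0],
    ⟨fun m n h => Finset.min'_subset _ (hFm h), fun m n h => Finset.max'_subset _ (hFm h)⟩,
    fun n => ⟨?_, ?_⟩, fun y hy => ?_⟩
  · obtain ⟨x, hx, hxy⟩ := hFs n _ (Finset.min'_mem _ (hFne (n + 1)))
    have h1 : ((F n).min' (hFne n) : ℝ) ≤ x := Subtype.coe_le_coe.2 (Finset.min'_le _ _ hx)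
    rw [Subtype.dist_eq, Real.dist_eq] at hxy
    have := (abs_le.1 hxy).2
    dsimp only
    linarith
  · obtain ⟨x, hx, hxy⟩ := hFs n _ (Finset.max'_mem _ (hFne (n + 1)))
    have h1 : (x : ℝ) ≤ (F n).max' (hFne n) := Subtype.coe_le_coe.2 (Finset.le_max' _ _ hx)
    rw [Subtype.dist_eq, Real.dist_eq] at hxy
    have := (abs_le.1 hxy).1
    dsimp only
    linarith
  · obtain ⟨i, hi⟩ := hup ⟨y, hy⟩
    obtain ⟨j, hj⟩ := hdown ⟨y, hy⟩
    obtain ⟨m, hm⟩ := hFf i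
    obtain ⟨k, hk⟩ := hFf j
    refine ⟨max m k, fun n hn => ⟨?_, ?_⟩⟩
    · exact (Finset.min'_le _ _ (hFm ((le_max_right m k).trans hn) hk)).trans hj
    · exact le_trans hi (Finset.le_max' _ _ (hFm ((le_max_left m k).trans hn) hm))

/-! ### Contracting the Vietoris–Rips complex of a set of reals -/

theorem dist_clamp_clamp_le (a b x y : ℝ) :
    dist (max a (min x b)) (max a (min y b)) ≤ dist x y := by
  rw [Real.dist_eq, Real.dist_eq]
  calc _ ≤ |min x b - min y b| := by
        simpa using abs_max_sub_max_le_max a (min x b) a (min y b)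
    _ ≤ |x - y| := by simpa using abs_min_sub_min_le_max x b y b

/-- Clamping to an interval and to an enlargement of it by at most `1` on either side are
contiguous on sets of diameter at most `1`. -/
theorem dist_clamp_clamp_le_one {a b a' b' x y : ℝ} (hab : a ≤ b) (ha : a' ≤ a) (hb : b ≤ b')
    (ha' : a - 1 ≤ a') (hb' : b' ≤ b + 1) (h : dist x y ≤ 1) :
    dist (max a (min x b)) (max a' (min y b')) ≤ 1 := by
  rw [Real.dist_eq, abs_le] at h ⊢
  obtain ⟨h1, h2⟩ := h
  rcases max_cases a (min x b) with h3 | h3 <;> rcases min_cases x b with h4 | h4 <;>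
  rcases max_cases a' (min y b') with h5 | h5 <;> rcases min_cases y b' with h6 | h6 <;>
  constructor <;> linarith

theorem mem_faces_ripsComplex {s : Finset ℝ} :
    s ∈ (ripsComplex 1 X).faces ↔
      s.Nonempty ∧ (∀ x ∈ s, x ∈ X) ∧ ∀ x ∈ s, ∀ y ∈ s, dist x y ≤ 1 := by
  refine and_congr_right fun _ => and_congr_right fun _ => ⟨fun h x hx y hy => ?_, fun h => ?_⟩
  · exact (Metric.dist_le_diam_of_mem s.finite_toSet.isBounded hx hy).trans h
  · exact Metric.diam_le_of_forall_dist_le zero_le_one h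

/-- The realization of the complex contracts, simultaneously in all chain classes, onto the chosen
points of the classes. The stages of the contraction clamp each class to an exhausting sequence
of intervals. -/
theorem exists_homotopy_id_chainBase (X : Set ℝ) :
    ∃ (φ : ℝ → ℝ) (H : C(I × (ripsComplex 1 X).Realization, (ripsComplex 1 X).Realization)),
      (∀ x : X, φ x = chainBase x) ∧ (∀ z, H (0, z) = z) ∧
        ∀ z, (H (1, z)).1 = z.1.mapDomain φ := by
  classical
  choose lo hi h0 hmono hstep hex using exists_exhausting_bounds (X := X)
  let ψ : ℕ → X → X := fun n x => max (lo (chainBase x) n) (min x (hi (chainBase x) n))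
  have hψ : ∀ n x, (ψ n x : ℝ) =
      max (lo (chainBase x) n : ℝ) (min (x : ℝ) (hi (chainBase x) n)) := fun n x => by
    have hm : Monotone ((↑) : X → ℝ) := Subtype.mono_coe X
    exact hm.map_max.trans (congrArg (max _) hm.map_min)
  have hlohi : ∀ x n, (lo x n : ℝ) ≤ hi x n := fun x n => by
    have h1 := (hmono x).1 n.zero_le
    have h2 := (hmono x).2 n.zero_le
    rw [(h0 x).1] at h1
    rw [(h0 x).2] at h2
    exact Subtype.coe_le_coe.2 (h1.trans h2)
  let φ : ℕ → ℝ → ℝ := fun n x => if h : x ∈ X then ψ n ⟨x, h⟩ else x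
  have hφ : ∀ n (x : X), φ n x = ψ n x := fun n x => dif_pos x.2
  have hφ0 : ∀ x : X, φ 0 x = chainBase x := fun x => by
    rw [hφ, hψ, (h0 _).1, (h0 _).2]
    exact max_eq_left (min_le_right _ _)
  suffices h : _ ∧ _ from
    let ⟨H, hH⟩ := (ripsComplex 1 X).exists_homotopy_id_of_contiguous φ h.1 h.2
    ⟨φ 0, H, hφ0, hH⟩
  constructor
  · intro s hs n
    obtain ⟨⟨x₀, hx₀⟩, hsX, hsd⟩ := mem_faces_ripsComplex.1 hs
    refine ⟨s.image (φ n) ∪ s.image (φ (n + 1)), ?_, fun x hx =>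
      ⟨Finset.mem_union_left _ (Finset.mem_image_of_mem _ hx),
        Finset.mem_union_right _ (Finset.mem_image_of_mem _ hx)⟩⟩
    let b := chainBase (⟨x₀, hsX x₀ hx₀⟩ : X)
    have hb : ∀ m, ∀ x ∈ s, φ m x = max (lo b m : ℝ) (min x (hi b m)) := by
      intro m x hx
      have : chainBase (⟨x, hsX x hx⟩ : X) = b :=
        chainBase_eq (chainSetoid_of_dist_le (hsd x hx x₀ hx₀))
      rw [hφ m ⟨x, hsX x hx⟩, hψ, this]
    have hstages : ∀ x ∈ s, ∀ y ∈ s, dist (φ n x) (φ (n + 1) y) ≤ 1 := fun x hx y hy => by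
      rw [hb n x hx, hb (n + 1) y hy]
      exact dist_clamp_clamp_le_one (hlohi b n)
        ((hmono b).1 n.le_succ) ((hmono b).2 n.le_succ) (hstep b n).1 (hstep b n).2 (hsd x hx y hy)
    have hstage : ∀ m, ∀ x ∈ s, ∀ y ∈ s, dist (φ m x) (φ m y) ≤ 1 := fun m x hx y hy => by
      rw [hb m x hx, hb m y hy]
      exact (dist_clamp_clamp_le _ _ _ _).trans (hsd x hx y hy)
    refine mem_faces_ripsComplex.2
      ⟨⟨_, Finset.mem_union_left _ (Finset.mem_image_of_mem _ hx₀)⟩, ?_, ?_⟩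
    · simp only [Finset.mem_union, Finset.mem_image]
      rintro _ (⟨x, hx, rfl⟩ | ⟨x, hx, rfl⟩) <;>
      · rw [hφ _ ⟨x, hsX x hx⟩]
        exact Subtype.coe_prop _
    · simp only [Finset.mem_union, Finset.mem_image]
      rintro _ (⟨x, hx, rfl⟩ | ⟨x, hx, rfl⟩) _ (⟨y, hy, rfl⟩ | ⟨y, hy, rfl⟩)
      · exact hstage n x hx y hy
      · exact hstages x hx y hy
      · rw [dist_comm]
        exact hstages y hy x hx
      · exact hstage (n + 1) x hx y hy
  · intro x
    by_cases hx : x ∈ X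
    · obtain ⟨N, hN⟩ := hex (chainBase ⟨x, hx⟩) ⟨x, hx⟩ (chainBase_rel _)
      refine ⟨N, fun n hn => ?_⟩
      rw [hφ n ⟨x, hx⟩, hψ]
      have h1 : (lo (chainBase ⟨x, hx⟩) n : ℝ) ≤ x := (hN n hn).1
      have h2 : x ≤ hi (chainBase ⟨x, hx⟩) n := (hN n hn).2
      rw [min_eq_left h2, max_eq_right h1]
    · exact ⟨0, fun n _ => dif_neg hx⟩

/-! ### The shadow of the Vietoris–Rips complex of a set of reals -/

theorem exists_mem_support_proj_mem_Icc {K : PreAbstractSimplicialComplex ℝ} (z : K.Realization) :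
    ∃ a ∈ z.1.support, ∃ b ∈ z.1.support, K.proj z ∈ Set.Icc a b := by
  refine ⟨_, z.1.support.min'_mem z.support_nonempty, _, z.1.support.max'_mem z.support_nonempty,
    ?_, ?_⟩
  · calc _ = z.1.sum fun _ w => w * z.1.support.min' z.support_nonempty := by
          rw [← Finsupp.sum_mul]; exact (congrArg (· * _) z.2.2.1).trans (one_mul _) |>.symm
      _ ≤ K.proj z := Finset.sum_le_sum fun v hv =>
          mul_le_mul_of_nonneg_left (Finset.min'_le _ _ hv) (z.2.1 v)
  · calc K.proj z ≤ z.1.sum fun _ w => w * z.1.support.max' z.support_nonempty :=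
          Finset.sum_le_sum fun v hv =>
            mul_le_mul_of_nonneg_left (Finset.le_max' _ _ hv) (z.2.1 v)
      _ = _ := by
          rw [← Finsupp.sum_mul]; exact (congrArg (· * _) z.2.2.1).trans (one_mul _)

theorem mem_shadow_ripsComplex {t : ℝ} :
    t ∈ (ripsComplex 1 X).shadow ↔ ∃ a b : X, (a : ℝ) ≤ t ∧ t ≤ b ∧ (b : ℝ) ≤ a + 1 := by
  constructor
  · rintro ⟨z, rfl⟩
    obtain ⟨a, ha, b, hb, hz⟩ := exists_mem_support_proj_mem_Icc z
    obtain ⟨-, hX, hd⟩ := mem_faces_ripsComplex.1 z.2.2.2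
    refine ⟨⟨a, hX a ha⟩, ⟨b, hX b hb⟩, hz.1, hz.2, ?_⟩
    have := (abs_le.1 (hd b hb a ha)).2
    dsimp only
    linarith
  · rintro ⟨a, b, hat, htb, hba⟩
    obtain ⟨α, β, hα, hβ, hαβ, rfl⟩ : t ∈ segment ℝ (a : ℝ) b :=
      Icc_subset_segment ⟨hat, htb⟩
    have hface : ({(a : ℝ), (b : ℝ)} : Finset ℝ) ∈ (ripsComplex 1 X).faces := by
      have : dist (a : ℝ) b ≤ 1 := by
        rw [Real.dist_eq, abs_le]; constructor <;> linarith
      refine mem_faces_ripsComplex.2 ⟨⟨a, by simp⟩, by simp, ?_⟩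
      simp only [Finset.mem_insert, Finset.mem_singleton]
      rintro x (rfl | rfl) y (rfl | rfl)
      · simp
      · exact this
      · rwa [dist_comm]
      · simp
    have hsum : ((Finsupp.single (a : ℝ) α + Finsupp.single (b : ℝ) β).sum fun _ w => w) = 1 := by
      rw [Finsupp.sum_add_index' (fun _ => rfl) (fun _ _ _ => rfl), Finsupp.sum_single_index rfl,
        Finsupp.sum_single_index rfl, hαβ]
    refine ⟨⟨Finsupp.single (a : ℝ) α + Finsupp.single (b : ℝ) β, fun v => ?_, hsum,
      PreAbstractSimplicialComplex.mem_faces_of_support_subset _ hface hsum ?_⟩, ?_⟩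
    · rw [Finsupp.add_apply, Finsupp.single_apply, Finsupp.single_apply]
      split_ifs <;> linarith
    · refine Finsupp.support_add.trans (Finset.union_subset ?_ ?_) <;>
      exact Finsupp.support_single_subset.trans (by simp)
    · change ((Finsupp.single (a : ℝ) α + Finsupp.single (b : ℝ) β).sum fun v w => w • v) = _
      rw [Finsupp.sum_add_index' (h := fun v w => w • v) (fun v => zero_smul ℝ v)
        (fun v w w' => add_smul w w' v),
        Finsupp.sum_single_index (h := fun v w => w • v) (zero_smul ℝ _),
        Finsupp.sum_single_index (h := fun v w => w • v) (zero_smul ℝ _)]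

theorem uIcc_subset_shadow {x y : X} (h : dist x y ≤ 1) :
    Set.uIcc (x : ℝ) y ⊆ (ripsComplex 1 X).shadow := by
  intro t ht
  have h' := abs_le.1 h
  rcases Set.mem_uIcc.1 ht with ht | ht
  · exact mem_shadow_ripsComplex.2 ⟨x, y, ht.1, ht.2, by linarith⟩
  · exact mem_shadow_ripsComplex.2 ⟨y, x, ht.1, ht.2, by linarith⟩

theorem uIcc_subset_shadow_of_chain {x y : X} (h : chainSetoid X x y) :
    Set.uIcc (x : ℝ) y ⊆ (ripsComplex 1 X).shadow := by
  change Relation.ReflTransGen _ x y at h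
  induction h with
  | refl => exact uIcc_subset_shadow (by simp)
  | tail _ hbc ih =>
    exact Set.uIcc_subset_uIcc_union_uIcc.trans (Set.union_subset ih (uIcc_subset_shadow hbc))

/-- All points of `X` at distance at most `1` from a given point of the shadow lie in one chain
class: each of them is at distance at most `1` from an end point of an edge above that point. -/
theorem chainSetoid_of_near_shadow {t : ℝ} (ht : t ∈ (ripsComplex 1 X).shadow) {x y : X}
    (hx : dist (x : ℝ) t ≤ 1) (hy : dist (y : ℝ) t ≤ 1) : chainSetoid X x y := by
  obtain ⟨a, b, hat, htb, hba⟩ := mem_shadow_ripsComplex.1 ht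
  have key : ∀ x : X, dist (x : ℝ) t ≤ 1 → chainSetoid X x a := by
    intro x hx
    rw [Real.dist_eq, abs_le] at hx
    rcases le_total (x : ℝ) t with h | h
    · refine chainSetoid_of_dist_le (abs_le.2 ⟨?_, ?_⟩) <;> linarith
    · refine (chainSetoid X).trans (chainSetoid_of_dist_le (y := b) (abs_le.2 ⟨?_, ?_⟩))
        (chainSetoid_of_dist_le (abs_le.2 ⟨?_, ?_⟩)) <;> linarith
  exact (chainSetoid X).trans (key x hx) ((chainSetoid X).symm (key y hy))

theorem exists_near_shadow (t : (ripsComplex 1 X).shadow) : ∃ x : X, dist (x : ℝ) t ≤ 1 := by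
  obtain ⟨a, b, hat, htb, hba⟩ := mem_shadow_ripsComplex.1 t.2
  exact ⟨a, abs_le.2 ⟨by linarith, by linarith⟩⟩

/-- The chosen point of the chain class near a point of the shadow. -/
noncomputable def shadowBase (t : (ripsComplex 1 X).shadow) : X :=
  chainBase (exists_near_shadow t).choose

theorem shadowBase_eq (t : (ripsComplex 1 X).shadow) {x : X} (hx : dist (x : ℝ) t ≤ 1) :
    shadowBase t = chainBase x :=
  chainBase_eq (chainSetoid_of_near_shadow t.2 (exists_near_shadow t).choose_spec hx)

/-- The upper end point of an edge above `t` is at distance at most `1` from both `t` and `u`. -/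
theorem shadowBase_eq_of_le {t u : (ripsComplex 1 X).shadow} (h : (t : ℝ) ≤ u)
    (h1 : (u : ℝ) ≤ t + 1) : shadowBase t = shadowBase u := by
  obtain ⟨a, b, hat, htb, hba⟩ := mem_shadow_ripsComplex.1 t.2
  have hb : dist (b : ℝ) t ≤ 1 := abs_le.2 ⟨by linarith, by linarith⟩
  have hb' : dist (b : ℝ) u ≤ 1 := abs_le.2 ⟨by linarith, by linarith⟩
  rw [shadowBase_eq t hb, shadowBase_eq u hb']

theorem isLocallyConstant_shadowBase :
    IsLocallyConstant (shadowBase : (ripsComplex 1 X).shadow → X) := by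
  refine (IsLocallyConstant.iff_eventually_eq _).2 fun t => ?_
  filter_upwards [Metric.ball_mem_nhds t zero_lt_one] with u hu
  have hu : |(u : ℝ) - t| < 1 := hu
  rw [abs_lt] at hu
  rcases le_total (t : ℝ) u with h | h
  · exact (shadowBase_eq_of_le h (by linarith)).symm
  · exact shadowBase_eq_of_le h (by linarith)

theorem uIcc_shadowBase_subset (t : (ripsComplex 1 X).shadow) :
    Set.uIcc (t : ℝ) (shadowBase t) ⊆ (ripsComplex 1 X).shadow := by
  obtain ⟨a, b, hat, htb, hba⟩ := mem_shadow_ripsComplex.1 t.2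
  have hta : Set.uIcc (t : ℝ) a ⊆ (ripsComplex 1 X).shadow := by
    rw [Set.uIcc_of_ge hat]
    exact fun u hu => mem_shadow_ripsComplex.2 ⟨a, b, hu.1, hu.2.trans htb, hba⟩
  rw [shadowBase_eq t (x := a) (abs_le.2 ⟨by linarith, by linarith⟩)]
  exact Set.uIcc_subset_uIcc_union_uIcc.trans (Set.union_subset hta
    (uIcc_subset_shadow_of_chain ((chainSetoid X).symm (chainBase_rel a))))

/-- The vertex of the realization at a point of `X`. -/
noncomputable def ripsVertex (x : X) : (ripsComplex 1 X).Realization :=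
  ⟨Finsupp.single (x : ℝ) 1, fun v => by
    rw [Finsupp.single_apply]; split_ifs <;> simp, Finsupp.sum_single_index rfl, by
    rw [Finsupp.support_single _ one_ne_zero, mem_faces_ripsComplex]
    simp⟩

theorem proj_ripsVertex (x : X) : (ripsComplex 1 X).proj (ripsVertex x) = x := by
  change ((Finsupp.single (x : ℝ) 1).sum fun v a => a • v) = x
  rw [Finsupp.sum_single_index (h := fun v a => a • v) (zero_smul ℝ _), one_smul]

theorem chainBase_eq_shadowBase (z : (ripsComplex 1 X).Realization) {x : ℝ}
    (hx : x ∈ z.1.support) (hxX : x ∈ X) :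
    chainBase (⟨x, hxX⟩ : X) = shadowBase ((ripsComplex 1 X).shadowProj z) := by
  obtain ⟨a, ha, b, hb, hz⟩ := exists_mem_support_proj_mem_Icc z
  obtain ⟨-, -, hd⟩ := mem_faces_ripsComplex.1 z.2.2.2
  have h1 := abs_le.1 (hd x hx a ha)
  have h2 := abs_le.1 (hd x hx b hb)
  exact (shadowBase_eq _ (abs_le.2 ⟨(by linarith [hz.2] : -1 ≤ x - (ripsComplex 1 X).proj z),
    (by linarith [hz.1] : x - (ripsComplex 1 X).proj z ≤ 1)⟩)).symm

end

theorem mainTheorem6 (X : Set ℝ) :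
    ∃ e : ContinuousMap.HomotopyEquiv (ripsComplex 1 X).Realization (ripsComplex 1 X).shadow,
      e.toFun = (ripsComplex 1 X).shadowProj := by
  let q : C((ripsComplex 1 X).shadow, (ripsComplex 1 X).Realization) :=
    ⟨fun t => ripsVertex (shadowBase t), (isLocallyConstant_shadowBase.comp ripsVertex).continuous⟩
  refine ⟨⟨(ripsComplex 1 X).shadowProj, q, ?_, ?_⟩, rfl⟩
  · obtain ⟨φ, H, hφ, hH0, hH1⟩ := exists_homotopy_id_chainBase X
    refine ContinuousMap.Homotopic.symm ⟨⟨H, hH0, fun z => Subtype.ext ?_⟩⟩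
    refine (hH1 z).trans ?_
    change z.1.mapDomain φ =
      Finsupp.single (shadowBase ((ripsComplex 1 X).shadowProj z) : ℝ) 1
    have hz : ∀ x ∈ z.1.support, φ x = shadowBase ((ripsComplex 1 X).shadowProj z) := by
      intro x hx
      have hxX := (mem_faces_ripsComplex.1 z.2.2.2).2.1 x hx
      rw [hφ ⟨x, hxX⟩, chainBase_eq_shadowBase z hx]
    rw [Finsupp.mapDomain_congr hz, Finsupp.mapDomain]
    refine Eq.trans ?_ (congrArg (Finsupp.single _) z.2.2.1)
    exact (map_sum (Finsupp.singleAddHom _) _ _).symm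
  · have hmem : ∀ p : I × (ripsComplex 1 X).shadow,
        AffineMap.lineMap (shadowBase p.2 : ℝ) (p.2 : ℝ) (p.1 : ℝ) ∈ (ripsComplex 1 X).shadow :=
      fun p => uIcc_shadowBase_subset p.2 <| by
        rw [← segment_eq_uIcc, segment_symm, segment_eq_image_lineMap]
        exact ⟨p.1, p.1.2, rfl⟩
    have hbase : Continuous fun t : (ripsComplex 1 X).shadow => (shadowBase t : ℝ) :=
      continuous_subtype_val.comp isLocallyConstant_shadowBase.continuous
    refine ⟨⟨⟨fun p => ⟨_, hmem p⟩, Continuous.subtype_mk ?_ hmem⟩, fun t => Subtype.ext ?_,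
      fun t => Subtype.ext ?_⟩⟩
    · simp only [AffineMap.lineMap_apply_module]
      have := hbase.comp (continuous_snd (X := I))
      exact ((continuous_const.sub (continuous_subtype_val.comp continuous_fst)).smul this).add
        ((continuous_subtype_val.comp continuous_fst).smul
          (continuous_subtype_val.comp continuous_snd))
    · exact (AffineMap.lineMap_apply_zero _ _).trans (proj_ripsVertex _).symm
    · exact AffineMap.lineMap_apply_one _ _
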